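/- Work in ZFC. For a cardinal $\kappa$ let $H_\kappa$ be the set of all sets whose transitive closure has fewer than $\kappa$ elements, and consider the structures $\langle H_{\omega_1},\in\rangle$ and $\langle H_{\omega_2},\in\rangle$ in the first-order language with the single binary relation symbol $\in$. A *real* is an element of the Cantor space $2^{\omega}$ (a subset of $\omega$). A subset of a Polish space is *projective* if it is (boldface) $\mathbf\Sigma^1_n$ for some $n\ge 1$, that is, if it is obtained from an analytic set by finitely many applications of complementation and projection along the Baire space. A relation $e\subseteq\omega\times\omega$ *codes* an ordinal $\alpha$ if $e$ is a (reflexive) well-order of a subset of $\omega$, of order type $\alpha$. An $\omega_1$-sequence $\langle a_\alpha\mid\alpha<\omega_1\rangle$ of reals is *projectively definable* if the set of all pairs $(e,a_\alpha)$ with $\alpha<\omega_1$ and $e$ a code of $\alpha$ is a projective subset of $2^{\omega\times\omega}\times 2^{\omega}$. A structure $N$ is *interpreted* in a structure $M$ if, for some finite $k$, there are a class $N^*\subseteq M^k$, relations and functions on it (the latter given by their graphs) for the symbols of the language of $N$, and an equivalence relation $\simeq$ on $N^*$ that is a congruence for them, all of them definable in $M$ with parameters, together with an isomorphism of $N$ with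 the quotient structure $N^*/{\simeq}$. Two structures are *mutually interpretable* if each is interpreted in the other. They are *bi-interpretable* if they are mutually interpretable by interpretations for which the two composite isomorphisms, of $M$ with its copy inside the copy of $N$ in $M$, and of $N$ with its copy inside the copy of $M$ in $N$, are definable (with parameters) in $M$ and in $N$, respectively. **Theorem.** Assume that there is no projectively definable $\omega_1$-sequence of distinct reals. Then $\langle H_{\omega_2},\in\rangle$ is not interpreted in $\langle H_{\omega_1},\in\rangle$. In particular, the structures $\langle H_{\omega_1},\in\rangle$ and $\langle H_{\omega_2},\in\rangle$ are not bi-interpretable, nor even mutually interpretable. -/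

import Mathlib

open Set

/-! ### Interpretations between first-order structures -/

universe u₁ v₁ w₁ u₂ v₂ w₂

/-- An interpretation of the `L'`-structure `N` in the `L`-structure `M`. The universe `N*` is a
definable class of `k`-tuples of elements of `M`, taken modulo a definable equivalence relation
`≃`; definability is in `M`, with parameters. The relations on `N*` for which `≃` is a congruence
are the same thing as relations on the quotient `N*/≃`, so the interpreted relations and functions
are given on the quotient, and their pullbacks to `N*` (graphs, for functions; constants are
functions of arity `0`) are required to be definable in `M`. -/
structure Interpretation (L' : FirstOrder.Language.{u₂, v₂}) (N : Type w₂) [L'.Structure N]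
    (L : FirstOrder.Language.{u₁, v₁}) (M : Type w₁) [L.Structure M] where
  k : ℕ
  domain : Set (Fin k → M)
  domain_definable : (univ : Set M).Definable L domain
  eqv : Setoid domain
  eqv_definable : (univ : Set M).Definable L
    {v : Fin 2 × Fin k → M | ∃ (h₀ : (fun t => v (0, t)) ∈ domain)
      (h₁ : (fun t => v (1, t)) ∈ domain), eqv ⟨_, h₀⟩ ⟨_, h₁⟩}
  [quotientStructure : L'.Structure (Quotient eqv)]
  rel_definable : ∀ (n : ℕ) (R : L'.Relations n), (univ : Set M).Definable L
    {v : Fin n × Fin k → M | ∃ h : ∀ i, (fun t => v (i, t)) ∈ domain,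
      quotientStructure.RelMap R (fun i => Quotient.mk eqv ⟨_, h i⟩)}
  fun_definable : ∀ (n : ℕ) (f : L'.Functions n), (univ : Set M).Definable L
    {v : (Fin n × Fin k) ⊕ Fin k → M | ∃ (h : ∀ i, (fun t => v (Sum.inl (i, t))) ∈ domain)
      (h' : (fun t => v (Sum.inr t)) ∈ domain),
      quotientStructure.funMap f (fun i => Quotient.mk eqv ⟨_, h i⟩) = Quotient.mk eqv ⟨_, h'⟩}
  /-- the isomorphism of `N` with the quotient structure -/
  iso : L'.Equiv N (Quotient eqv)

attribute [instance] Interpretation.quotientStructure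

/-- `N` is interpreted in `M`. -/
def IsInterpretedIn (L' : FirstOrder.Language.{u₂, v₂}) (N : Type w₂) [L'.Structure N]
    (L : FirstOrder.Language.{u₁, v₁}) (M : Type w₁) [L.Structure M] : Prop :=
  Nonempty (Interpretation L' N L M)

/-- Each of `M` and `N` is interpreted in the other. -/
def MutuallyInterpretable (L : FirstOrder.Language.{u₁, v₁}) (M : Type w₁) [L.Structure M]
    (L' : FirstOrder.Language.{u₂, v₂}) (N : Type w₂) [L'.Structure N] : Prop :=
  IsInterpretedIn L' N L M ∧ IsInterpretedIn L M L' N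

/-- Given interpretations `I` of `N` in `M` and `J` of `M` in `N`, this is the graph of the
isomorphism of `M` with its copy inside the copy of `N` inside `M`, as a relation between elements
`a` of `M` (the `Sum.inl` coordinate) and representatives of elements of that copy. Such a
representative is a `J.k`-tuple of elements of `I.domain`, that is, a `J.k × I.k` array of elements
of `M`; it is related to `a` if the tuple of elements of `N` that it represents is in the class
`J.iso a`. -/
def Interpretation.compGraph {L : FirstOrder.Language.{u₁, v₁}} {M : Type w₁} [L.Structure M]
    {L' : FirstOrder.Language.{u₂, v₂}} {N : Type w₂} [L'.Structure N]
    (I : Interpretation L' N L M) (J : Interpretation L M L' N) :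
    Set (Unit ⊕ (Fin J.k × Fin I.k) → M) :=
  {v | ∃ (h : ∀ s, (fun t => v (Sum.inr (s, t))) ∈ I.domain)
    (h' : (fun s => I.iso.toEquiv.symm (Quotient.mk I.eqv ⟨_, h s⟩)) ∈ J.domain),
    J.iso.toEquiv (v (Sum.inl ())) = Quotient.mk J.eqv ⟨_, h'⟩}

/-- `M` and `N` are mutually interpretable in such a way that the two composite isomorphisms,
of `M` with its copy in its copy of `N` and of `N` with its copy in its copy of `M`, are definable
in `M` and in `N` respectively. -/
def BiInterpretable (L : FirstOrder.Language.{u₁, v₁}) (M : Type w₁) [L.Structure M]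
    (L' : FirstOrder.Language.{u₂, v₂}) (N : Type w₂) [L'.Structure N] : Prop :=
  ∃ (I : Interpretation L' N L M) (J : Interpretation L M L' N),
    (univ : Set M).Definable L (I.compGraph J) ∧ (univ : Set N).Definable L' (J.compGraph I)

/-! ### The structures `⟨H_κ, ∈⟩` -/

/-- The only symbol of the language of set theory: the binary relation symbol `∈`. -/
inductive SetTheoryRel : ℕ → Type
  | mem : SetTheoryRel 2

/-- The first-order language of set theory. -/
def setLanguage : FirstOrder.Language.{0, 0} := ⟨fun _ => Empty, SetTheoryRel⟩

/-- `H_κ`, the class of the sets whose transitive closure has fewer than `κ` elements; since the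
transitive closure of `x` is the least transitive set including `x`, this says that some transitive
set including `x` has fewer than `κ` elements. -/
def hereditary (κ : Cardinal.{w₁}) : Set ZFSet.{w₁} :=
  {x | ∃ t : ZFSet.{w₁}, t.IsTransitive ∧ x ⊆ t ∧ t.card < κ}

/-- The structure `⟨A, ∈⟩` for a class `A` of sets. -/
instance memStructure (A : Set ZFSet.{w₁}) : setLanguage.Structure A where
  funMap := fun f => Empty.elim f
  RelMap := fun {_} R => match R with
    | SetTheoryRel.mem => fun v => (v 0 : ZFSet.{w₁}) ∈ (v 1 : ZFSet.{w₁})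

/-! ### Projectively definable sequences of reals -/

/-- `IsSigmaOne n A` says that `A` is `Σ¹_{n+1}` (boldface): the `Σ¹₁` sets are the analytic ones,
and the `Σ¹_{n+2}` sets are the projections along Baire space of complements of `Σ¹_{n+1}` sets. -/
def IsSigmaOne : ℕ → ∀ {X : Type} [TopologicalSpace X], Set X → Prop
  | 0, _, _, A => MeasureTheory.AnalyticSet A
  | n + 1, X, _, A => ∃ B : Set (X × (ℕ → ℕ)), IsSigmaOne n Bᶜ ∧ A = Prod.fst '' B

/-- A set in a Polish space is projective if it is `Σ¹_n` for some `n ≥ 1`. -/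
def IsProjective {X : Type} [TopologicalSpace X] (A : Set X) : Prop :=
  ∃ n, IsSigmaOne n A

/-- `e`, the characteristic function of a binary relation on `ℕ`, codes the ordinal `α`: the
relation is a (reflexive) well-order, of a subset of `ℕ`, of order type `α`. -/
def CodesOrdinal (e : ℕ × ℕ → Bool) (α : Ordinal.{0}) : Prop :=
  ∃ g : Iio α → ℕ, Function.Injective g ∧
    ∀ m n, e (m, n) = true ↔ ∃ β γ : Iio α, β ≤ γ ∧ g β = m ∧ g γ = n

/-- The `ω₁`-sequence `a` of reals (points of the Cantor space `ℕ → Bool`, i.e. subsets of `ℕ`) is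
projectively definable: the set of the pairs `(e, a α)`, where `e` is a code of the countable
ordinal `α`, is projective. -/
def ProjectivelyDefinable (a : Iio (Ordinal.omega.{0} 1) → (ℕ → Bool)) : Prop :=
  IsProjective {p : (ℕ × ℕ → Bool) × (ℕ → Bool) |
    ∃ α : Iio (Ordinal.omega.{0} 1), CodesOrdinal p.1 α ∧ p.2 = a α}

/-! # `H_{ω₂}` is not interpretable in `H_{ω₁}` without a projective `ω₁`-sequence of reals

Suppose that `⟨H_{ω₂}, ∈⟩` is interpreted in `⟨H_{ω₁}, ∈⟩`. The proof shows that then every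
`ω₁`-sequence of reals is projectively definable; since there are at least `ℵ₁` reals, some such
sequence consists of distinct ones.

Every real `e : ℕ × ℕ → Bool` codes a hereditarily countable set `decode e`, the Mostowski collapse
of the node `0` of the well-founded relation that `e` represents (`decode_surjective`). Equality of
the coded sets is the existence of a bisimulation, and well-foundedness is `Π¹₁`; so equality and
membership are projective in the codes, and, as quantifiers over `H_{ω₁}` become quantifiers over
codes, so is every relation definable in `⟨H_{ω₁}, ∈⟩` with parameters
(`isProjective_of_definable_hereditary`). Through the interpretation, tuples of codes thus name all
the elements of `H_{ω₂}`, with projective equality and membership of the named sets.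

For a sequence `a` of reals, the sets `A_α = {A_β | β < α} ∪ a α ∪ {ω}` and the set `{A_α | α < ω₁}`
belong to `H_{ω₂}`, so that they have names (`seqSet_hereditary`). A real `e` codes `α`, and
`x = a α`, if and only if some sequence of names enumerates along the field of `e`, in the order
given by `e`, the predecessors `A_β` of a set `A_α` whose elements in `ω` are those of `x`
(`codesOrdinal_iff`). The sequence ranges over a Polish space, so the condition is projective
(`projectivelyDefinable_of_names`). -/

/-! ### Closure properties of the projective sets -/

section Projective

-- Direct instances, which spare instance search the detour through separability of each product,
-- too long for products of many factors.
instance polishSpace_bool : PolishSpace Bool := inferInstance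

instance polishSpace_nat : PolishSpace ℕ := inferInstance

instance polishSpace_prod {X Y : Type*} [TopologicalSpace X] [PolishSpace X] [TopologicalSpace Y]
    [PolishSpace Y] : PolishSpace (X × Y) := inferInstance

instance polishSpace_pi {ι : Type*} [Countable ι] {X : ι → Type*} [∀ i, TopologicalSpace (X i)]
    [∀ i, PolishSpace (X i)] : PolishSpace (∀ i, X i) := inferInstance

variable {X Y : Type} [TopologicalSpace X] [PolishSpace X] [TopologicalSpace Y] [PolishSpace Y]

theorem IsSigmaOne.preimage {n : ℕ} : ∀ {X Y : Type} [TopologicalSpace X] [PolishSpace X]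
    [TopologicalSpace Y] [PolishSpace Y] {A : Set Y} {f : X → Y},
    IsSigmaOne n A → Continuous f → IsSigmaOne n (f ⁻¹' A) := by
  induction n with
  | zero =>
    intro X Y _ _ _ _ A f hA hf
    exact MeasureTheory.AnalyticSet.preimage hA hf
  | succ n ih =>
    rintro X Y _ _ _ _ A f ⟨B, hB, rfl⟩ hf
    refine ⟨Prod.map f id ⁻¹' B, ?_, ?_⟩
    · rw [← preimage_compl]
      exact ih hB (hf.prodMap continuous_id)
    · ext x
      simp

theorem IsSigmaOne.succ {n : ℕ} : ∀ {X : Type} [TopologicalSpace X] [PolishSpace X] {A : Set X},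
    IsSigmaOne n A → IsSigmaOne (n + 1) A := by
  induction n with
  | zero =>
    intro X _ _ A hA
    -- an analytic set is the projection of the graph of a continuous function
    rcases (MeasureTheory.analyticSet_iff_exists_polishSpace_range.1 hA) with
      ⟨Y, _, _, f, hf, rfl⟩
    rcases isEmpty_or_nonempty Y with hY | hY
    · refine ⟨∅, ?_, by simp [range_eq_empty]⟩
      rw [compl_empty]
      exact isClosed_univ.analyticSet
    · obtain ⟨g, hg, hgs⟩ := PolishSpace.exists_nat_nat_continuous_surjective Y
      have hfg : Continuous (f ∘ g) := hf.comp hg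
      refine ⟨{p | f (g p.2) = p.1}, ?_, ?_⟩
      · have hc : IsClosed {p : X × (ℕ → ℕ) | f (g p.2) = p.1} :=
          isClosed_eq (hfg.comp continuous_snd) continuous_fst
        borelize (X × (ℕ → ℕ))
        exact hc.isOpen_compl.measurableSet.analyticSet
      · ext x
        simp [hgs.exists]
  | succ n ih =>
    rintro X _ _ A ⟨B, hB, rfl⟩
    exact ⟨B, ih hB, rfl⟩

theorem IsSigmaOne.mono {m n : ℕ} (h : m ≤ n) {A : Set X} (hA : IsSigmaOne m A) :
    IsSigmaOne n A := by
  induction h with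
  | refl => exact hA
  | step _ ih => exact ih.succ

theorem IsSigmaOne.compl {n : ℕ} {A : Set X} (hA : IsSigmaOne n A) : IsSigmaOne (n + 1) Aᶜ := by
  refine ⟨Prod.fst ⁻¹' Aᶜ, ?_, ?_⟩
  · rw [← preimage_compl, compl_compl]
    exact hA.preimage continuous_fst
  · rw [image_preimage_eq _ Prod.fst_surjective]

theorem IsSigmaOne.inter_union {n : ℕ} : ∀ {X : Type} [TopologicalSpace X] [PolishSpace X]
    {A B : Set X}, IsSigmaOne n A → IsSigmaOne n B →
      IsSigmaOne n (A ∩ B) ∧ IsSigmaOne n (A ∪ B) := by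
  induction n with
  | zero =>
    intro X _ _ A B hA hB
    rw [inter_eq_iInter, union_eq_iUnion]
    exact ⟨MeasureTheory.AnalyticSet.iInter (by rintro (_ | _) <;> assumption),
      MeasureTheory.AnalyticSet.iUnion (by rintro (_ | _) <;> assumption)⟩
  | succ n ih =>
    rintro X _ _ _ _ ⟨A, hA, rfl⟩ ⟨B, hB, rfl⟩
    constructor
    · obtain ⟨g, hg, hgs⟩ :=
        PolishSpace.exists_nat_nat_continuous_surjective ((ℕ → ℕ) × (ℕ → ℕ))
      refine ⟨(fun p => (p.1, (g p.2).1)) ⁻¹' A ∩ (fun p => (p.1, (g p.2).2)) ⁻¹' B, ?_, ?_⟩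
      · rw [compl_inter, ← preimage_compl, ← preimage_compl]
        exact (ih (hA.preimage (by fun_prop)) (hB.preimage (by fun_prop))).2
      · ext x
        constructor
        · rintro ⟨⟨⟨x, y⟩, hy, rfl⟩, ⟨⟨_, z⟩, hz, rfl⟩⟩
          obtain ⟨w, hw⟩ := hgs (y, z)
          exact ⟨(_, w), ⟨by simpa [hw] using hy, by simpa [hw] using hz⟩, rfl⟩
        · rintro ⟨⟨x, w⟩, ⟨h₁, h₂⟩, rfl⟩
          exact ⟨⟨_, h₁, rfl⟩, ⟨_, h₂, rfl⟩⟩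
    · refine ⟨A ∪ B, ?_, (image_union _ _ _).symm⟩
      rw [compl_union]
      exact (ih hA hB).1

/-- Projection along any Polish space `Y`, and not only along Baire space, since `Y × (ℕ → ℕ)` is a
continuous image of Baire space. -/
theorem IsSigmaOne.exists {n : ℕ} [Nonempty Y] {P : X → Y → Prop}
    (h : IsSigmaOne n {p : X × Y | P p.1 p.2}) : IsSigmaOne n {x | ∃ y, P x y} := by
  cases n with
  | zero =>
    have h' : MeasureTheory.AnalyticSet (Prod.fst '' {p : X × Y | P p.1 p.2}) :=
      MeasureTheory.AnalyticSet.image_of_continuous h continuous_fst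
    have : {x | ∃ y, P x y} = Prod.fst '' {p : X × Y | P p.1 p.2} := by
      ext x
      simp
    rw [this]
    exact h'
  | succ n =>
    obtain ⟨B, hB, h⟩ := h
    obtain ⟨g, hg, hgs⟩ := PolishSpace.exists_nat_nat_continuous_surjective (Y × (ℕ → ℕ))
    refine ⟨(fun p => ((p.1, (g p.2).1), (g p.2).2)) ⁻¹' B, ?_, ?_⟩
    · rw [← preimage_compl]
      exact hB.preimage (by fun_prop)
    · ext x
      have : ∀ y, P x y ↔ ∃ z, ((x, y), z) ∈ B := fun y => by
        simpa using Set.ext_iff.1 h (x, y)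
      constructor
      · rintro ⟨y, hy⟩
        obtain ⟨z, hz⟩ := (this y).1 hy
        obtain ⟨w, hw⟩ := hgs (y, z)
        exact ⟨(x, w), by simpa [hw], rfl⟩
      · rintro ⟨⟨x, w⟩, hw, rfl⟩
        exact ⟨_, (this _).2 ⟨_, hw⟩⟩

theorem IsClosed.isProjective {A : Set X} (hA : IsClosed A) : IsProjective A :=
  ⟨0, hA.analyticSet⟩

/-- A condition on a value of a continuous function into a discrete space is projective. -/
theorem isProjective_discrete {D : Type*} [TopologicalSpace D] [DiscreteTopology D] {f : X → D}
    (hf : Continuous f) (s : D → Prop) : IsProjective {x | s (f x)} :=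
  IsClosed.isProjective ((isClosed_discrete {d | s d}).preimage hf)

theorem isProjective_const (p : Prop) : IsProjective {_x : X | p} :=
  isProjective_discrete (f := fun _ => ()) continuous_const fun _ => p

theorem IsProjective.comp {P : Y → Prop} (h : IsProjective {y | P y}) {f : X → Y}
    (hf : Continuous f) : IsProjective {x | P (f x)} :=
  let ⟨n, hn⟩ := h
  ⟨n, hn.preimage hf⟩

variable {P Q : X → Prop}

theorem IsProjective.not (h : IsProjective {x | P x}) : IsProjective {x | ¬ P x} :=
  let ⟨n, hn⟩ := h
  ⟨n + 1, hn.compl⟩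

theorem IsProjective.and (hP : IsProjective {x | P x}) (hQ : IsProjective {x | Q x}) :
    IsProjective {x | P x ∧ Q x} :=
  let ⟨m, hm⟩ := hP
  let ⟨n, hn⟩ := hQ
  ⟨max m n, ((hm.mono (le_max_left m n)).inter_union (hn.mono (le_max_right m n))).1⟩

theorem IsProjective.or (hP : IsProjective {x | P x}) (hQ : IsProjective {x | Q x}) :
    IsProjective {x | P x ∨ Q x} := by
  simpa only [not_and_or, not_not] using (hP.not.and hQ.not).not

theorem IsProjective.imp (hP : IsProjective {x | P x}) (hQ : IsProjective {x | Q x}) :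
    IsProjective {x | P x → Q x} := by
  simpa only [imp_iff_not_or] using hP.not.or hQ

theorem IsProjective.iff (hP : IsProjective {x | P x}) (hQ : IsProjective {x | Q x}) :
    IsProjective {x | P x ↔ Q x} := by
  simpa only [iff_def] using (hP.imp hQ).and (hQ.imp hP)

theorem IsProjective.exists [Nonempty Y] {P : X → Y → Prop}
    (h : IsProjective {p : X × Y | P p.1 p.2}) : IsProjective {x | ∃ y, P x y} :=
  let ⟨n, hn⟩ := h
  ⟨n, hn.exists⟩

theorem IsProjective.forall [Nonempty Y] {P : X → Y → Prop}
    (h : IsProjective {p : X × Y | P p.1 p.2}) : IsProjective {x | ∀ y, P x y} := by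
  simpa only [not_exists, not_not] using h.not.exists (P := fun x y => ¬ P x y).not

/-- Substituting a function that is continuous on the two sides of a projective case distinction. -/
theorem IsProjective.comp_ite {R : Y → Prop} (hR : IsProjective {y | R y})
    (hP : IsProjective {x | P x}) [DecidablePred P] {f g : X → Y} (hf : Continuous f)
    (hg : Continuous g) : IsProjective {x | R (if P x then f x else g x)} := by
  have : ∀ x, R (if P x then f x else g x) ↔ (P x → R (f x)) ∧ (¬ P x → R (g x)) := by
    intro x
    split_ifs with h <;> simp [h]
  simpa only [this] using (hP.imp (hR.comp hf)).and (hP.not.imp (hR.comp hg))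

theorem IsProjective.comp_ite_fst {D : Y → Prop} (hD : IsProjective {y | D y}) [DecidablePred D]
    (y₀ : Y) {P : Y → X → Prop} (h : IsProjective {p : Y × X | P p.1 p.2}) :
    IsProjective {p : Y × X | P (if D p.1 then p.1 else y₀) p.2} := by
  convert h.comp_ite (X := Y × X) (hD.comp (P := D) continuous_fst) (f := id)
    (g := fun p => (y₀, p.2)) (by fun_prop) (by fun_prop) using 2
  ext p
  split_ifs <;> rfl

theorem IsProjective.comp_ite_prod {D : Y → Prop} (hD : IsProjective {y | D y}) [DecidablePred D]
    (y₀ : Y) {P : Y → Y → Prop} (h : IsProjective {p : Y × Y | P p.1 p.2}) :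
    IsProjective {p : Y × Y | P (if D p.1 then p.1 else y₀) (if D p.2 then p.2 else y₀)} := by
  have h₁ := (hD.comp_ite_fst y₀ h).comp (P := fun p : Y × Y =>
    P (if D p.1 then p.1 else y₀) p.2) (f := Prod.swap) (by fun_prop)
  have h₂ := hD.comp_ite_fst y₀ (P := fun z w => P (if D w then w else y₀) z) h₁
  exact h₂.comp (P := fun p : Y × Y =>
    P (if D p.2 then p.2 else y₀) (if D p.1 then p.1 else y₀)) (f := Prod.swap) (by fun_prop)

end Projective

theorem Continuous.eval_discrete {X ι Y : Type*} [TopologicalSpace X] [TopologicalSpace ι]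
    [DiscreteTopology ι] [TopologicalSpace Y] {f : X → ι → Y} {i : X → ι} (hf : Continuous f)
    (hi : Continuous i) : Continuous fun x => f x (i x) := by
  have : Continuous fun p : (ι → Y) × ι => p.1 p.2 :=
    continuous_prod_of_discrete_right.2 fun i => continuous_apply i
  exact this.comp (hf.prodMk hi)

/-! ### Definability over a coded structure -/

/-- Let `π` map a Polish space of codes onto a relational structure `M`, so that equality and the
basic relations are projective in the codes. Then first-order truth is projective in the codes. -/
theorem isProjective_realize {L : FirstOrder.Language} [L.IsRelational] {M : Type*}
    [L.Structure M] {C : Type} [TopologicalSpace C] [PolishSpace C] [Nonempty C] {π : C → M}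
    (hπ : Function.Surjective π) (heq : IsProjective {p : C × C | π p.1 = π p.2})
    (hrel : ∀ (l : ℕ) (R : L.Relations l), IsProjective
      {c : Fin l → C | FirstOrder.Language.Structure.RelMap R fun i => π (c i)})
    {β : Type*} {n : ℕ} (φ : L.BoundedFormula β n) :
    ∀ {X : Type} [TopologicalSpace X] [PolishSpace X] {v : β → X → C} {xs : Fin n → X → C},
      (∀ b, Continuous (v b)) → (∀ i, Continuous (xs i)) →
      IsProjective {x | φ.Realize (fun b => π (v b x)) fun i => π (xs i x)} := by
  have term : ∀ {X : Type} [TopologicalSpace X] [PolishSpace X] {n : ℕ} {v : β → X → C}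
      {xs : Fin n → X → C}, (∀ b, Continuous (v b)) → (∀ i, Continuous (xs i)) →
      ∀ t : L.Term (β ⊕ Fin n), ∃ f : X → C, Continuous f ∧
        ∀ x, t.realize (Sum.elim (fun b => π (v b x)) fun i => π (xs i x)) = π (f x) := by
    intro X _ _ n v xs hv hxs t
    cases t with
    | var b =>
      cases b with
      | inl b => exact ⟨v b, hv b, fun x => rfl⟩
      | inr i => exact ⟨xs i, hxs i, fun x => rfl⟩
    | func f _ => exact isEmptyElim f
  induction φ with
  | falsum =>
    intro X _ _ v xs hv hxs
    exact isProjective_const False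
  | equal t₁ t₂ =>
    intro X _ _ v xs hv hxs
    obtain ⟨f₁, hf₁, h₁⟩ := term hv hxs t₁
    obtain ⟨f₂, hf₂, h₂⟩ := term hv hxs t₂
    simp only [FirstOrder.Language.BoundedFormula.Realize, h₁, h₂]
    exact heq.comp (hf₁.prodMk hf₂)
  | rel R ts =>
    intro X _ _ v xs hv hxs
    choose f hf h using fun i => term hv hxs (ts i)
    simp only [FirstOrder.Language.BoundedFormula.Realize, h]
    exact (hrel _ R).comp (continuous_pi hf)
  | imp φ ψ hφ hψ =>
    intro X _ _ v xs hv hxs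
    exact (hφ hv hxs).imp (hψ hv hxs)
  | @all n φ ih =>
    intro X _ _ v xs hv hxs
    have := (ih (X := X × C) (v := fun b p => v b p.1)
      (xs := Fin.snoc (α := fun _ => X × C → C) (fun i p => xs i p.1) Prod.snd)
      (fun b => (hv b).comp continuous_fst) (fun i => by
        refine Fin.lastCases ?_ (fun i => ?_) i
        · simpa using continuous_snd
        · simpa [Function.comp_def] using (hxs i).comp continuous_fst))
    have h : ∀ x : X × C, (fun i => π (Fin.snoc (α := fun _ => X × C → C)
        (fun i p => xs i p.1) Prod.snd i x)) =
        Fin.snoc (α := fun _ => M) (fun i => π (xs i x.1)) (π x.2) := by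
      intro x
      ext i
      refine Fin.lastCases ?_ (fun i => ?_) i <;> simp
    simp only [h] at this
    simpa only [FirstOrder.Language.BoundedFormula.Realize, hπ.forall] using
      this.forall (P := fun x c => φ.Realize (fun b => π (v b x))
        (Fin.snoc (α := fun _ => M) (fun i => π (xs i x)) (π c)))

/-- In the situation of `isProjective_realize`, definability with parameters is projective in the
codes, since each parameter has a code. -/
theorem Set.Definable.isProjective {L : FirstOrder.Language} [L.IsRelational] {M : Type*}
    [L.Structure M] {C : Type} [TopologicalSpace C] [PolishSpace C] [Nonempty C] {π : C → M}
    (hπ : Function.Surjective π) (heq : IsProjective {p : C × C | π p.1 = π p.2})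
    (hrel : ∀ (l : ℕ) (R : L.Relations l), IsProjective
      {c : Fin l → C | FirstOrder.Language.Structure.RelMap R fun i => π (c i)})
    {A : Set M} {β : Type*} {S : Set (β → M)} (hS : A.Definable L S)
    {X : Type} [TopologicalSpace X] [PolishSpace X] {v : β → X → C} (hv : ∀ b, Continuous (v b)) :
    IsProjective {x | (fun b => π (v b x)) ∈ S} := by
  obtain ⟨φ, rfl⟩ := definable_iff_exists_formula_sum.1 hS
  obtain ⟨σ, hσ⟩ := hπ.hasRightInverse
  have := isProjective_realize hπ heq hrel φ (X := X)
    (v := Sum.elim (fun a _ => σ a) v) (xs := Fin.elim0)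
    (by rintro (a | b); exacts [continuous_const, hv b]) (fun i => i.elim0)
  convert this using 2
  ext x
  simp only [mem_ofPred_eq, FirstOrder.Language.Formula.Realize]
  refine iff_of_eq ?_
  congr 1
  · ext (a | b) <;> simp [hσ _]
  · exact Subsingleton.elim _ _

/-! ### Reals coding hereditarily countable sets -/

/-- The binary relation on `ℕ` with characteristic function `e`. -/
def codeRel (e : ℕ × ℕ → Bool) (m n : ℕ) : Prop := e (m, n) = true

open Classical in
/-- The relation coded by `e` if it is well-founded, and the empty relation otherwise; with
it, every real becomes a code. -/
noncomputable def wfPart (e : ℕ × ℕ → Bool) : ℕ × ℕ → Bool :=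
  if WellFounded (codeRel e) then e else fun _ => false

theorem wellFounded_wfPart (e : ℕ × ℕ → Bool) : WellFounded (codeRel (wfPart e)) := by
  unfold wfPart
  split_ifs with h
  · exact h
  · exact ⟨fun n => ⟨n, fun m hm => by simp [codeRel] at hm⟩⟩

/-- The Mostowski collapse of the node `n` of the well-founded relation `wfPart e`. -/
noncomputable def decodeNode (e : ℕ × ℕ → Bool) : ℕ → ZFSet.{0} :=
  (wellFounded_wfPart e).fix fun n ih =>
    ZFSet.range fun m : {m // codeRel (wfPart e) m n} => ih m m.2

theorem mem_decodeNode {e : ℕ × ℕ → Bool} {n : ℕ} {x : ZFSet} :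
    x ∈ decodeNode e n ↔ ∃ m, codeRel (wfPart e) m n ∧ decodeNode e m = x := by
  conv_lhs => rw [decodeNode, WellFounded.fix_eq]
  simp [decodeNode]

/-- The collapse of a node is hereditarily countable: the collapses of all nodes form a countable
transitive set that includes it. -/
theorem decodeNode_mem_hereditary (e : ℕ × ℕ → Bool) (n : ℕ) :
    decodeNode e n ∈ hereditary (Cardinal.aleph.{0} 1) := by
  have ht : ∀ n, decodeNode e n ⊆ ZFSet.range (decodeNode e) := fun n x hx => by
    obtain ⟨m, -, rfl⟩ := mem_decodeNode.1 hx
    simp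
  refine ⟨ZFSet.range (decodeNode e), fun y hy => ?_, ht n, ?_⟩
  · obtain ⟨m, rfl⟩ := ZFSet.mem_range.1 hy
    exact ht m
  · have := ZFSet.lift_card_range_le (f := decodeNode e)
    simp only [Cardinal.lift_uzero, Cardinal.mk_nat] at this
    exact this.trans_lt (by simp)

/-- The hereditarily countable set coded by `e`: the collapse of the node `0`. -/
noncomputable def decode (e : ℕ × ℕ → Bool) : hereditary (Cardinal.aleph.{0} 1) :=
  ⟨decodeNode e 0, decodeNode_mem_hereditary e 0⟩

theorem decode_surjective : Function.Surjective decode := by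
  classical
  rintro ⟨x, t, ht, hxt, hcard⟩
  have hc : (insert x (t : Set ZFSet.{0})).Countable := by
    refine Countable.insert _ ?_
    have h : Cardinal.mk t < Cardinal.aleph 1 := by
      rw [ZFSet.cardinalMk_coe_sort,
        show Cardinal.aleph.{1} 1 = Cardinal.lift.{1} (Cardinal.aleph.{0} 1) by simp,
        Cardinal.lift_lt]
      exact hcard
    rw [← Cardinal.succ_aleph0, Order.lt_succ_iff] at h
    exact Cardinal.mk_le_aleph0_iff.1 h
  obtain ⟨s₁, hs₁⟩ := hc.exists_eq_range ⟨x, mem_insert _ _⟩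
  -- an enumeration of `t` and `x` that lists `x` first
  let s : ℕ → ZFSet := fun n => Nat.casesOn n x s₁
  have hs : range s = insert x (t : Set ZFSet.{0}) := by
    ext y
    rw [hs₁]
    constructor
    · rintro ⟨_ | n, rfl⟩
      · exact hs₁ ▸ mem_insert _ _
      · exact ⟨n, rfl⟩
    · rintro ⟨n, rfl⟩
      exact ⟨n + 1, rfl⟩
  let e : ℕ × ℕ → Bool := fun p => decide (s p.1 ∈ s p.2)
  have he : ∀ m n, codeRel e m n ↔ s m ∈ s n := fun m n => by simp [codeRel, e]
  have hwf : WellFounded (codeRel e) :=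
    Subrelation.wf (fun {m n} h => (he m n).1 h) (InvImage.wf s ZFSet.mem_wf)
  have hwe : wfPart e = e := if_pos hwf
  have hd : ∀ n, decodeNode e n = s n := by
    intro n
    induction n using hwf.induction with
    | _ n ih =>
      ext y
      rw [mem_decodeNode, hwe]
      constructor
      · rintro ⟨m, hm, rfl⟩
        rw [ih m hm]
        exact (he _ _).1 hm
      · intro hy
        have hyt : y ∈ t := by
          rcases (hs ▸ mem_range_self n : s n ∈ insert x (t : Set ZFSet)) with h | h
          · exact hxt (h ▸ hy)
          · exact ht _ h hy
        obtain ⟨m, rfl⟩ : y ∈ range s := hs ▸ mem_insert_of_mem _ hyt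
        exact ⟨m, (he _ _).2 hy, ih m ((he _ _).2 hy)⟩
  exact ⟨e, Subtype.ext (hd 0)⟩

/-- `R` is a bisimulation between the relations coded by `e` and `d`. -/
def IsBisimulation (e d R : ℕ × ℕ → Bool) : Prop :=
  ∀ m n, codeRel R m n →
    (∀ m', codeRel e m' m → ∃ n', codeRel d n' n ∧ codeRel R m' n') ∧
    ∀ n', codeRel d n' n → ∃ m', codeRel e m' m ∧ codeRel R m' n'

/-- Nodes of well-founded relations have the same collapse if and only if they are bisimilar. -/
theorem decodeNode_eq_iff {e d : ℕ × ℕ → Bool} {m n : ℕ} :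
    decodeNode e m = decodeNode d n ↔
      ∃ R, IsBisimulation (wfPart e) (wfPart d) R ∧ codeRel R m n := by
  classical
  constructor
  · intro h
    refine ⟨fun p => decide (decodeNode e p.1 = decodeNode d p.2), fun m n hR => ?_, by
      simpa [codeRel] using h⟩
    have hR' : decodeNode e m = decodeNode d n := by simpa [codeRel] using hR
    refine ⟨fun m' hm' => ?_, fun n' hn' => ?_⟩
    · obtain ⟨n', hn', h⟩ := mem_decodeNode.1 (hR' ▸ mem_decodeNode.2 ⟨m', hm', rfl⟩)
      exact ⟨n', hn', by simp [codeRel, h]⟩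
    · obtain ⟨m', hm', h⟩ := mem_decodeNode.1 (hR' ▸ mem_decodeNode.2 ⟨n', hn', rfl⟩)
      exact ⟨m', hm', by simp [codeRel, h]⟩
  · rintro ⟨R, hR, hmn⟩
    induction m using (wellFounded_wfPart e).induction generalizing n with
    | _ m ih =>
      ext x
      simp only [mem_decodeNode]
      constructor
      · rintro ⟨m', hm', rfl⟩
        obtain ⟨n', hn', h⟩ := (hR m n hmn).1 m' hm'
        exact ⟨n', hn', (ih m' hm' h).symm⟩
      · rintro ⟨n', hn', rfl⟩
        obtain ⟨m', hm', h⟩ := (hR m n hmn).2 n' hn'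
        exact ⟨m', hm', ih m' hm' h⟩

section

variable {X : Type} [TopologicalSpace X] [PolishSpace X]

theorem isProjective_codeRel {e : X → ℕ × ℕ → Bool} {m n : X → ℕ} (he : Continuous e)
    (hm : Continuous m) (hn : Continuous n) : IsProjective {x | codeRel (e x) (m x) (n x)} :=
  isProjective_discrete (he.eval_discrete (hm.prodMk hn)) fun b => b = true

theorem isProjective_wellFounded :
    IsProjective {e : ℕ × ℕ → Bool | WellFounded (codeRel e)} := by
  have : ∀ e, WellFounded (codeRel e) ↔ ¬ ∃ f : ℕ → ℕ, ∀ n, codeRel e (f (n + 1)) (f n) := by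
    intro e
    rw [wellFounded_iff_isEmpty_descending_chain, isEmpty_subtype, not_exists]
  simp only [this]
  refine (IsProjective.exists (IsProjective.forall ?_)).not
  exact isProjective_codeRel (by fun_prop)
    (Continuous.eval_discrete (by fun_prop)
      ((continuous_of_discreteTopology (f := Nat.succ)).comp continuous_snd))
    (Continuous.eval_discrete (by fun_prop) continuous_snd)

theorem isProjective_isBisimulation :
    IsProjective {p : ((ℕ × ℕ → Bool) × (ℕ × ℕ → Bool)) × (ℕ × ℕ → Bool) |
      IsBisimulation p.1.1 p.1.2 p.2} := by
  unfold IsBisimulation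
  refine .forall (.forall (.imp ?_ (.and (.forall (.imp ?_ (.exists (.and ?_ ?_))))
    (.forall (.imp ?_ (.exists (.and ?_ ?_)))))))
  all_goals exact isProjective_codeRel (by fun_prop) (by fun_prop) (by fun_prop)

/-- Replacing a code by its well-founded part preserves projectivity, as the well-founded codes form
a projective set. -/
theorem IsProjective.comp_wfPart {P : (ℕ × ℕ → Bool) → X → Prop}
    (h : IsProjective {p : (ℕ × ℕ → Bool) × X | P p.1 p.2}) :
    IsProjective {p : (ℕ × ℕ → Bool) × X | P (wfPart p.1) p.2} := by
  classical
  exact isProjective_wellFounded.comp_ite_fst (fun _ => false) h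

end

/-- Equality of coded sets is projective, being the existence of a bisimulation. -/
theorem isProjective_decodeNode_eq :
    IsProjective {p : (ℕ × ℕ → Bool) × (ℕ × ℕ → Bool) × ℕ × ℕ |
      decodeNode p.1 p.2.2.1 = decodeNode p.2.1 p.2.2.2} := by
  simp only [decodeNode_eq_iff]
  refine IsProjective.comp_wfPart (X := (ℕ × ℕ → Bool) × ℕ × ℕ)
    (P := fun e q => ∃ R, IsBisimulation e (wfPart q.1) R ∧ codeRel R q.2.1 q.2.2) ?_
  have h := IsProjective.comp_wfPart (X := (ℕ × ℕ → Bool) × ℕ × ℕ)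
    (P := fun d q => ∃ R, IsBisimulation q.1 d R ∧ codeRel R q.2.1 q.2.2) ?_
  · exact h.comp (P := fun q : (ℕ × ℕ → Bool) × (ℕ × ℕ → Bool) × ℕ × ℕ =>
      ∃ R, IsBisimulation q.2.1 (wfPart q.1) R ∧ codeRel R q.2.2.1 q.2.2.2)
      (f := fun p : (ℕ × ℕ → Bool) × (ℕ × ℕ → Bool) × ℕ × ℕ => (p.2.1, p.1, p.2.2)) (by fun_prop)
  · refine .exists (.and ?_ ?_)
    · exact isProjective_isBisimulation.comp (P := fun p => IsBisimulation p.1.1 p.1.2 p.2)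
        (f := fun p : ((ℕ × ℕ → Bool) × (ℕ × ℕ → Bool) × ℕ × ℕ) × (ℕ × ℕ → Bool) =>
          ((p.1.2.1, p.1.1), p.2)) (by fun_prop)
    · exact isProjective_codeRel (by fun_prop) (by fun_prop) (by fun_prop)

theorem isProjective_decode_eq :
    IsProjective {p : (ℕ × ℕ → Bool) × (ℕ × ℕ → Bool) | decode p.1 = decode p.2} := by
  simp only [decode, Subtype.mk.injEq]
  exact isProjective_decodeNode_eq.comp (P := fun p => decodeNode p.1 p.2.2.1 =
    decodeNode p.2.1 p.2.2.2) (f := fun p : (ℕ × ℕ → Bool) × (ℕ × ℕ → Bool) => (p.1, p.2, 0, 0))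
    (by fun_prop)

theorem isProjective_decode_mem :
    IsProjective {p : (ℕ × ℕ → Bool) × (ℕ × ℕ → Bool) |
      (decode p.1 : ZFSet) ∈ (decode p.2 : ZFSet)} := by
  simp only [decode, mem_decodeNode]
  refine .exists (.and ?_ ?_)
  · have h := (IsProjective.comp_wfPart (P := fun d n => codeRel d n 0)
      (isProjective_codeRel continuous_fst continuous_snd continuous_const))
    exact h.comp (P := fun q : (ℕ × ℕ → Bool) × ℕ => codeRel (wfPart q.1) q.2 0)
      (f := fun p : ((ℕ × ℕ → Bool) × (ℕ × ℕ → Bool)) × ℕ => (p.1.2, p.2)) (by fun_prop)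
  · exact isProjective_decodeNode_eq.comp (P := fun p => decodeNode p.1 p.2.2.1 =
      decodeNode p.2.1 p.2.2.2)
      (f := fun p : ((ℕ × ℕ → Bool) × (ℕ × ℕ → Bool)) × ℕ => (p.1.2, p.1.1, p.2, 0))
      (by fun_prop)

instance setLanguage_isRelational : setLanguage.IsRelational :=
  fun _ => inferInstanceAs (IsEmpty Empty)

/-- A set definable with parameters in `⟨H_{ω₁}, ∈⟩` is projective in the codes. -/
theorem isProjective_of_definable_hereditary {A : Set (hereditary (Cardinal.aleph.{0} 1))}
    {β : Type*} {S : Set (β → hereditary (Cardinal.aleph.{0} 1))}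
    (hS : A.Definable setLanguage S) {X : Type} [TopologicalSpace X] [PolishSpace X]
    {v : β → X → (ℕ × ℕ → Bool)} (hv : ∀ b, Continuous (v b)) :
    IsProjective {x | (fun b => decode (v b x)) ∈ S} := by
  refine hS.isProjective decode_surjective isProjective_decode_eq (fun l R => ?_) hv
  cases R with
  | mem =>
    exact isProjective_decode_mem.comp
      (P := fun p => (decode p.1 : ZFSet) ∈ (decode p.2 : ZFSet))
      (f := fun c : Fin 2 → (ℕ × ℕ → Bool) => (c 0, c 1)) (by fun_prop)

/-! ### An `ω₁`-sequence of reals as a set in `H_{ω₂}` -/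

/-- The recursively defined sets `A_α = {A_β | β < α} ∪ {i | i ∈ a α} ∪ {ω}`, where `i < ω` is
identified with a von Neumann ordinal. The order of the indices and the reals `a α` can be read off
from membership among the `A_α` and in them; the element `ω` separates the `A_α` from the natural
numbers. -/
noncomputable def seqSet (a : Iio (Ordinal.omega.{0} 1) → ℕ → Bool) :
    Iio (Ordinal.omega.{0} 1) → ZFSet.{0} :=
  wellFounded_lt.fix fun α A =>
    ZFSet.range (fun β : {β // β < α} => A β β.2) ∪
      (ZFSet.range (fun i : {i : ℕ // a α i = true} => (i : Ordinal.{0}).toZFSet) ∪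
        {Ordinal.omega0.toZFSet})

variable {a : Iio (Ordinal.omega.{0} 1) → ℕ → Bool} {α β : Iio (Ordinal.omega.{0} 1)}

theorem mem_seqSet {x : ZFSet} : x ∈ seqSet a α ↔ (∃ β < α, seqSet a β = x) ∨
    (∃ i : ℕ, a α i = true ∧ (i : Ordinal).toZFSet = x) ∨ x = Ordinal.omega0.toZFSet := by
  conv_lhs => rw [seqSet, WellFounded.fix_eq]
  simp [seqSet]

theorem seqSet_ne_toZFSet {o : Ordinal} (h : o ≤ Ordinal.omega0) :
    seqSet a α ≠ o.toZFSet := by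
  intro e
  have : Ordinal.omega0.toZFSet ∈ seqSet a α := mem_seqSet.2 (.inr (.inr rfl))
  rw [e, Ordinal.toZFSet_mem_toZFSet_iff] at this
  exact this.not_ge h

theorem seqSet_ne_nat {i : ℕ} : seqSet a α ≠ (i : Ordinal).toZFSet :=
  seqSet_ne_toZFSet (Ordinal.natCast_lt_omega0 i).le

theorem seqSet_injective : Function.Injective (seqSet a) := by
  have h : ∀ {α β}, α < β → seqSet a α ≠ seqSet a β := fun {α β} hlt e =>
    ZFSet.mem_irrefl (seqSet a β) (mem_seqSet.2 (.inl ⟨α, hlt, e⟩))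
  intro α β e
  rcases lt_trichotomy α β with hlt | rfl | hlt
  exacts [(h hlt e).elim, rfl, (h hlt e.symm).elim]

theorem seqSet_mem_seqSet : seqSet a β ∈ seqSet a α ↔ β < α := by
  rw [mem_seqSet]
  constructor
  · rintro (⟨γ, hγ, e⟩ | ⟨i, -, e⟩ | e)
    · exact seqSet_injective e ▸ hγ
    · exact (seqSet_ne_nat e.symm).elim
    · exact (seqSet_ne_toZFSet le_rfl e).elim
  · exact fun h => .inl ⟨β, h, rfl⟩

theorem nat_mem_seqSet {i : ℕ} : (i : Ordinal).toZFSet ∈ seqSet a α ↔ a α i = true := by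
  rw [mem_seqSet]
  constructor
  · rintro (⟨γ, -, e⟩ | ⟨j, hj, e⟩ | e)
    · exact (seqSet_ne_nat e).elim
    · have := Ordinal.toZFSet_injective e
      rw [Nat.cast_inj] at this
      exact this ▸ hj
    · exact ((Ordinal.natCast_lt_omega0 i).ne (Ordinal.toZFSet_injective e)).elim
  · exact fun h => .inr (.inl ⟨i, h, rfl⟩)

/-- All the sets needed to describe `a` belong to `H_{ω₂}`, since they are subsets of a single
transitive set of cardinality at most `ℵ₁`: the sets `A_α` together with the ordinals up to `ω`. -/
theorem seqSet_hereditary :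
    ZFSet.range (seqSet a) ∈ hereditary (Cardinal.aleph.{0} 2) ∧
    (∀ α, seqSet a α ∈ hereditary (Cardinal.aleph.{0} 2)) ∧
    ∀ i : ℕ, (i : Ordinal).toZFSet ∈ hereditary (Cardinal.aleph.{0} 2) := by
  let t : ZFSet := ZFSet.range (seqSet a) ∪ (Ordinal.omega0 + 1).toZFSet
  have hmem : ∀ x, x ∈ t ↔ (∃ α, seqSet a α = x) ∨ ∃ o ≤ Ordinal.omega0, o.toZFSet = x := by
    intro x
    simp only [t, ZFSet.mem_union, ZFSet.mem_range, Ordinal.mem_toZFSet_iff, Order.lt_add_one_iff]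
  have ht : t.IsTransitive := by
    intro x hx y hy
    rw [hmem] at hx ⊢
    obtain ⟨α, rfl⟩ | ⟨o, ho, rfl⟩ := hx
    · obtain ⟨β, -, e⟩ | ⟨i, -, e⟩ | e := mem_seqSet.1 hy
      · exact .inl ⟨β, e⟩
      · exact .inr ⟨i, (Ordinal.natCast_lt_omega0 i).le, e⟩
      · exact .inr ⟨_, le_rfl, e.symm⟩
    · obtain ⟨o', ho', e⟩ := Ordinal.mem_toZFSet_iff.1 hy
      exact .inr ⟨o', ho'.le.trans ho, e⟩
  have hcard : t.card < Cardinal.aleph 2 := by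
    have h₁₂ : Cardinal.aleph.{0} 1 < Cardinal.aleph 2 :=
      Cardinal.aleph_lt_aleph.2 (by norm_num)
    refine (ZFSet.card_union_le).trans_lt (Cardinal.add_lt_of_lt (Cardinal.aleph0_le_aleph 2) ?_ ?_)
    · refine lt_of_le_of_lt ?_ h₁₂
      have := ZFSet.lift_card_range_le (f := seqSet a)
      rw [Cardinal.mk_Iio_ordinal] at this
      simpa using this
    · rw [Ordinal.card_toZFSet]
      refine lt_of_le_of_lt ?_ h₁₂
      simp
  have hsub : ∀ x ∈ t, x ∈ hereditary (Cardinal.aleph.{0} 2) := fun x hx => ⟨t, ht, ht x hx, hcard⟩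
  exact ⟨⟨t, ht, fun x hx => (hmem x).2 (.inl (ZFSet.mem_range.1 hx)), hcard⟩,
    fun α => hsub _ ((hmem _).2 (.inl ⟨α, rfl⟩)),
    fun i => hsub _ ((hmem _).2 (.inr ⟨i, (Ordinal.natCast_lt_omega0 i).le, rfl⟩))⟩

theorem exists_injective_reals :
    ∃ a : Iio (Ordinal.omega.{0} 1) → (ℕ → Bool), Function.Injective a := by
  have h : Cardinal.lift.{0} (Cardinal.mk (Iio (Ordinal.omega.{0} 1))) ≤
      Cardinal.lift.{1} (Cardinal.mk (ℕ → Bool)) := by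
    rw [Cardinal.mk_Iio_ordinal]
    simpa using Cardinal.aleph_one_le_continuum
  obtain ⟨f⟩ := Cardinal.lift_mk_le'.1 h
  exact ⟨f, f.injective⟩

/-! ### Recovering the sequence from a projective copy of `H_{ω₂}` -/

/-- A description, by equality and membership alone, of the pairs of a code of `α` and the real
`a α`: the point `z` names some `A_α`, the points `f m` with `m` in the field of `e` name exactly
its predecessors `A_β`, in the order given by `e`, and `x` is read off from the natural numbers in
`A_α`. -/
theorem codesOrdinal_iff {Z : Type} {ρ : Z → ZFSet.{0}} (hρ : ∀ α, ∃ z, ρ z = seqSet a α)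
    {e : ℕ × ℕ → Bool} {x : ℕ → Bool} :
    (∃ α : Iio (Ordinal.omega.{0} 1), CodesOrdinal e α ∧ x = a α) ↔
    ∃ f : ℕ → Z, ∃ z, ρ z ∈ ZFSet.range (seqSet a) ∧
      (∀ m, e (m, m) = true → ρ (f m) ∈ ZFSet.range (seqSet a) ∧ ρ (f m) ∈ ρ z) ∧
      (∀ m n, e (m, n) = true ↔ (e (m, m) = true ∧ e (n, n) = true) ∧
        (ρ (f m) ∈ ρ (f n) ∨ ρ (f m) = ρ (f n))) ∧
      (∀ m n, e (m, n) = true → e (n, m) = true → m = n) ∧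
      (∀ w, ρ w ∈ ZFSet.range (seqSet a) → ρ w ∈ ρ z →
        ∃ m, e (m, m) = true ∧ ρ w = ρ (f m)) ∧
      ∀ i : ℕ, x i = true ↔ (i : Ordinal).toZFSet ∈ ρ z := by
  choose r hr using hρ
  constructor
  · rintro ⟨α, ⟨g, hg, he⟩, rfl⟩
    have hK : ∀ β : Iio (α : Ordinal), (β : Ordinal) ∈ Iio (Ordinal.omega.{0} 1) :=
      fun β => mem_Iio.2 (lt_trans (mem_Iio.1 β.2) (mem_Iio.1 α.2))
    let ι : Iio (α : Ordinal) → Iio (Ordinal.omega.{0} 1) := fun β => ⟨β, hK β⟩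
    have hdiag : ∀ m, e (m, m) = true ↔ ∃ β, g β = m := fun m => by
      rw [he]
      exact ⟨fun ⟨β, _, _, h, _⟩ => ⟨β, h⟩, fun ⟨β, h⟩ => ⟨β, β, le_rfl, h, h⟩⟩
    have hee : ∀ β γ, e (g β, g γ) = true ↔ β ≤ γ := fun β γ => by
      rw [he]
      exact ⟨fun ⟨β', γ', h, h₁, h₂⟩ => hg h₁ ▸ hg h₂ ▸ h, fun h => ⟨β, γ, h, rfl, rfl⟩⟩
    let f : ℕ → Z := Function.extend g (fun β => r (ι β)) fun _ => r α
    have hf : ∀ β, f (g β) = r (ι β) := fun β => hg.extend_apply _ _ β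
    refine ⟨f, r α, by simp [hr], ?_, ?_, ?_, ?_, ?_⟩
    · intro m hm
      obtain ⟨β, rfl⟩ := (hdiag m).1 hm
      rw [hf, hr, hr, seqSet_mem_seqSet]
      exact ⟨by simp, β.2⟩
    · intro m n
      constructor
      · intro h
        obtain ⟨β, γ, hβγ, rfl, rfl⟩ := (he m n).1 h
        refine ⟨⟨(hdiag _).2 ⟨_, rfl⟩, (hdiag _).2 ⟨_, rfl⟩⟩, ?_⟩
        rw [hf, hf, hr, hr, seqSet_mem_seqSet]
        rcases hβγ.lt_or_eq with h | rfl
        exacts [.inl h, .inr rfl]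
      · rintro ⟨⟨hm, hn⟩, h⟩
        obtain ⟨β, rfl⟩ := (hdiag m).1 hm
        obtain ⟨γ, rfl⟩ := (hdiag n).1 hn
        rw [hf, hf, hr, hr, seqSet_mem_seqSet] at h
        rw [hee]
        rcases h with h | h
        · exact le_of_lt h
        · have h' := congrArg Subtype.val (seqSet_injective h)
          exact (Subtype.ext h' : β = γ).le
    · intro m n h₁ h₂
      obtain ⟨β, γ, hβγ, rfl, rfl⟩ := (he m n).1 h₁
      rw [le_antisymm hβγ ((hee _ _).1 h₂)]
    · intro w hw hwz
      obtain ⟨β, hβ⟩ := ZFSet.mem_range.1 hw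
      rw [← hβ, hr, seqSet_mem_seqSet] at hwz
      let β' : Iio (α : Ordinal) := ⟨β, hwz⟩
      refine ⟨g β', (hdiag _).2 ⟨_, rfl⟩, ?_⟩
      rw [hf, hr, ← hβ]
    · intro i
      rw [hr, nat_mem_seqSet]
  · rintro ⟨f, z, hz, hfield, he, hanti, hsurj, hx⟩
    obtain ⟨α, hα⟩ := ZFSet.mem_range.1 hz
    rw [← hα] at hfield hsurj hx
    refine ⟨α, ?_, ?_⟩
    · have hK : ∀ β : Iio (α : Ordinal), (β : Ordinal) ∈ Iio (Ordinal.omega.{0} 1) :=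
        fun β => mem_Iio.2 (lt_trans (mem_Iio.1 β.2) (mem_Iio.1 α.2))
      let ι : Iio (α : Ordinal) → Iio (Ordinal.omega.{0} 1) := fun β => ⟨β, hK β⟩
      have h : ∀ β : Iio (α : Ordinal), ∃ m, e (m, m) = true ∧ seqSet a (ι β) = ρ (f m) := by
        intro β
        rw [← hr (ι β)]
        refine hsurj (r (ι β)) (by simp [hr]) ?_
        rw [hr, seqSet_mem_seqSet]
        exact β.2
      choose g hge hg using h
      have hι : ∀ {β γ : Iio (α : Ordinal)}, ι β = ι γ → β = γ := fun h =>
        Subtype.ext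
          (congrArg (fun x : Iio (Ordinal.omega.{0} 1) => (x : Ordinal)) h)
      refine ⟨g, fun β γ hβγ => ?_, fun m n => ⟨fun hmn => ?_, ?_⟩⟩
      · refine hι (seqSet_injective (a := a) ?_)
        rw [hg, hg, hβγ]
      · -- `f` maps the field of `e` to predecessors of `A_α`, so its points are values of `g`
        have hfld : ∀ m, e (m, m) = true → ∃ β, g β = m := by
          intro m hm
          obtain ⟨h₁, h₂⟩ := hfield m hm
          obtain ⟨β, hβ⟩ := ZFSet.mem_range.1 h₁
          rw [← hβ, seqSet_mem_seqSet] at h₂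
          let β' : Iio (α : Ordinal) := ⟨β, h₂⟩
          have heq : ρ (f (g β')) = ρ (f m) := by rw [← hg, ← hβ]
          exact ⟨β', hanti _ _ ((he _ _).2 ⟨⟨hge _, hm⟩, .inr heq⟩)
            ((he _ _).2 ⟨⟨hm, hge _⟩, .inr heq.symm⟩)⟩
        obtain ⟨⟨hm, hn⟩, h⟩ := (he m n).1 hmn
        obtain ⟨β, rfl⟩ := hfld m hm
        obtain ⟨γ, rfl⟩ := hfld n hn
        refine ⟨β, γ, ?_, rfl, rfl⟩
        rw [← hg, ← hg, seqSet_mem_seqSet] at h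
        rcases h with h | h
        · exact le_of_lt h
        · exact (hι (seqSet_injective h)).le
      · rintro ⟨β, γ, hβγ, rfl, rfl⟩
        refine (he _ _).2 ⟨⟨hge _, hge _⟩, ?_⟩
        rw [← hg, ← hg, seqSet_mem_seqSet]
        rcases hβγ.lt_or_eq with h | rfl
        exacts [.inl h, .inr rfl]
    · ext i
      rw [Bool.eq_iff_iff, hx, nat_mem_seqSet]

/-- If every set in `H_{ω₂}` is named by a point of a Polish space, so that equality and membership
are projective in the names, then every `ω₁`-sequence of reals is projectively definable. -/
theorem projectivelyDefinable_of_names {Z : Type} [TopologicalSpace Z] [PolishSpace Z]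
    {ρ : Z → ZFSet.{0}} (hsurj : ∀ x ∈ hereditary (Cardinal.aleph.{0} 2), ∃ z, ρ z = x)
    (hE : IsProjective {p : Z × Z | ρ p.1 = ρ p.2})
    (hM : IsProjective {p : Z × Z | ρ p.1 ∈ ρ p.2})
    (a : Iio (Ordinal.omega.{0} 1) → (ℕ → Bool)) : ProjectivelyDefinable a := by
  obtain ⟨hS, hA, hN⟩ := seqSet_hereditary (a := a)
  obtain ⟨s, hs⟩ := hsurj _ hS
  choose c hc using fun i => hsurj _ (hN i)
  have : Nonempty Z := ⟨s⟩
  have eq : ∀ {X : Type} [TopologicalSpace X] [PolishSpace X] {f g : X → Z}, Continuous f →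
      Continuous g → IsProjective {x | ρ (f x) = ρ (g x)} := fun hf hg =>
    hE.comp (P := fun p : Z × Z => ρ p.1 = ρ p.2) (hf.prodMk hg)
  have mem : ∀ {X : Type} [TopologicalSpace X] [PolishSpace X] {f g : X → Z}, Continuous f →
      Continuous g → IsProjective {x | ρ (f x) ∈ ρ (g x)} := fun hf hg =>
    hM.comp (P := fun p : Z × Z => ρ p.1 ∈ ρ p.2) (hf.prodMk hg)
  have bool : ∀ {X : Type} [TopologicalSpace X] [PolishSpace X] {f : X → Bool}, Continuous f →
      IsProjective {x | f x = true} := fun hf => isProjective_discrete hf fun b => b = true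
  have natEq : ∀ {X : Type} [TopologicalSpace X] [PolishSpace X] {f g : X → ℕ}, Continuous f →
      Continuous g → IsProjective {x | f x = g x} := fun hf hg =>
    isProjective_discrete (hf.prodMk hg) fun p => p.1 = p.2
  have nat : Continuous c := continuous_of_discreteTopology
  unfold ProjectivelyDefinable
  simp only [codesOrdinal_iff fun α => hsurj _ (hA α), ← hs, ← hc]
  refine .exists (.exists (.and ?_ (.and (.forall (.imp ?_ (.and ?_ ?_))) (.and
    (.forall (.forall (.iff ?_ (.and (.and ?_ ?_) (.or ?_ ?_)))))
    (.and (.forall (.forall (.imp ?_ (.imp ?_ ?_)))) (.and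
      (.forall (.imp ?_ (.imp ?_ (.exists (.and ?_ ?_))))) (.forall (.iff ?_ ?_))))))))
  all_goals first
    | refine mem ?_ ?_
    | refine eq ?_ ?_
    | refine bool ?_
    | refine natEq ?_ ?_
  all_goals first
    | fun_prop
    | exact Continuous.eval_discrete (by fun_prop) (by fun_prop)

/-! ### Interpretations of `⟨H_{ω₂}, ∈⟩` in `⟨H_{ω₁}, ∈⟩` -/

theorem not_isInterpretedIn_hereditary
    (h : ¬ ∃ a : Iio (Ordinal.omega.{0} 1) → (ℕ → Bool),
      Function.Injective a ∧ ProjectivelyDefinable a) :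
    ¬ IsInterpretedIn setLanguage (hereditary (Cardinal.aleph.{0} 2))
        setLanguage (hereditary (Cardinal.aleph.{0} 1)) := by
  classical
  rintro ⟨I⟩
  obtain ⟨a, ha⟩ := exists_injective_reals
  refine h ⟨a, ha, ?_⟩
  -- tuples of codes name the elements of the interpreted copy of `H_{ω₂}`
  let Z := Fin I.k → (ℕ × ℕ → Bool)
  let D : Z → Prop := fun z => (fun t => decode (z t)) ∈ I.domain
  have hrep : ∀ x : hereditary (Cardinal.aleph.{0} 2), ∃ z : Z, ∃ hz : D z,
      I.iso x = Quotient.mk I.eqv ⟨_, hz⟩ := by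
    intro x
    obtain ⟨⟨w, hw⟩, hq⟩ := Quotient.exists_rep (I.iso x)
    choose z hz using fun t => decode_surjective (w t)
    have hwz : w = fun t => decode (z t) := funext fun t => (hz t).symm
    subst hwz
    exact ⟨z, hw, hq.symm⟩
  obtain ⟨z₀, hz₀, -⟩ := hrep ⟨_, (seqSet_hereditary (a := a)).1⟩
  -- tuples outside the domain serve as further names for the set named by `z₀`
  let ν : Z → Z := fun z => if D z then z else z₀
  have hν : ∀ z, D (ν z) := fun z => by
    by_cases hz : D z
    · simp [ν, hz]
    · simpa [ν, hz] using hz₀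
  let q : Z → Quotient I.eqv := fun z => Quotient.mk I.eqv ⟨_, hν z⟩
  have hD : IsProjective {z : Z | D z} :=
    isProjective_of_definable_hereditary I.domain_definable (X := Z) (v := fun t z => z t)
      (by fun_prop)
  refine projectivelyDefinable_of_names (Z := Z)
    (ρ := fun z => (I.iso.toEquiv.symm (q z) : ZFSet)) ?_ ?_ ?_ a
  · intro x hx
    obtain ⟨z, hz, hxz⟩ := hrep ⟨x, hx⟩
    refine ⟨z, ?_⟩
    have : q z = I.iso ⟨x, hx⟩ := by
      rw [hxz]
      simp only [q, ν, if_pos hz]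
    rw [this]
    exact congrArg Subtype.val (I.iso.toEquiv.symm_apply_apply ⟨x, hx⟩)
  · have := isProjective_of_definable_hereditary I.eqv_definable (X := Z × Z)
      (v := fun b p => if b.1 = 0 then p.1 b.2 else p.2 b.2) (by
        intro b
        split_ifs <;> fun_prop)
    have := hD.comp_ite_prod z₀ (P := fun z w => ∃ (hz : D z) (hw : D w),
      I.eqv ⟨_, hz⟩ ⟨_, hw⟩) this
    convert this using 2
    ext p
    have h₁ : q p.1 = q p.2 ↔ I.eqv ⟨_, hν p.1⟩ ⟨_, hν p.2⟩ := Quotient.eq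
    simp only [Subtype.coe_inj, Equiv.apply_eq_iff_eq, h₁]
    exact ⟨fun h => ⟨hν _, hν _, h⟩, fun ⟨_, _, h⟩ => h⟩
  · have := isProjective_of_definable_hereditary (I.rel_definable 2 SetTheoryRel.mem) (X := Z × Z)
      (v := fun b p => if b.1 = 0 then p.1 b.2 else p.2 b.2) (by
        intro b
        split_ifs <;> fun_prop)
    have := hD.comp_ite_prod z₀ (P := fun z w => ∃ (hz : D z) (hw : D w),
      I.quotientStructure.RelMap (SetTheoryRel.mem : setLanguage.Relations 2)
        ![Quotient.mk I.eqv ⟨_, hz⟩, Quotient.mk I.eqv ⟨_, hw⟩]) (by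
      convert this using 2
      ext p
      refine ⟨fun ⟨hz, hw, h⟩ => ⟨fun i => ?_, ?_⟩, fun ⟨hi, h⟩ => ⟨hi 0, hi 1, ?_⟩⟩
      · fin_cases i
        exacts [hz, hw]
      · convert h using 1
        ext i
        fin_cases i <;> rfl
      · convert h using 1
        ext i
        fin_cases i <;> rfl)
    convert this using 2
    ext p
    have h₁ := I.iso.map_rel (SetTheoryRel.mem : setLanguage.Relations 2)
      ![I.iso.toEquiv.symm (q p.1), I.iso.toEquiv.symm (q p.2)]
    have h₂ : I.iso ∘ ![I.iso.toEquiv.symm (q p.1), I.iso.toEquiv.symm (q p.2)] =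
        ![q p.1, q p.2] := by
      ext i
      fin_cases i
      · exact I.iso.toEquiv.apply_symm_apply _
      · exact I.iso.toEquiv.apply_symm_apply _
    rw [h₂] at h₁
    exact h₁.symm.trans ⟨fun h => ⟨hν _, hν _, h⟩, fun ⟨_, _, h⟩ => h⟩

theorem mainTheorem11
    (h : ¬ ∃ a : Iio (Ordinal.omega.{0} 1) → (ℕ → Bool),
      Function.Injective a ∧ ProjectivelyDefinable a) :
    ¬ IsInterpretedIn setLanguage (hereditary (Cardinal.aleph.{0} 2))
        setLanguage (hereditary (Cardinal.aleph.{0} 1)) ∧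
    ¬ BiInterpretable setLanguage (hereditary (Cardinal.aleph.{0} 1))
        setLanguage (hereditary (Cardinal.aleph.{0} 2)) ∧
    ¬ MutuallyInterpretable setLanguage (hereditary (Cardinal.aleph.{0} 1))
        setLanguage (hereditary (Cardinal.aleph.{0} 2)) := by
  have hI := not_isInterpretedIn_hereditary h
  exact ⟨hI, fun ⟨I, _⟩ => hI ⟨I⟩, fun hM => hI hM.1⟩
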